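/- Let $n\ge 1$, let $\kappa_1\ge\cdots\ge\kappa_n\ge 0$ be integers and let $m=\kappa_1+\cdots+\kappa_n$; put $\kappa_2:=0$ if $n=1$. The partition polytope $\mathrm{PP}(\kappa_1,\dots,\kappa_n)$ is the set of all real $n\times m$ arrays $(y_{ij})$ such that $\sum_{j=1}^m y_{ij}=\kappa_i$ for all $1\le i\le n$, $\sum_{i=1}^n y_{ij}=1$ for all $1\le j\le m$, and $y_{ij}\ge 0$ for all $i,j$. The combinatorial diameter of a polytope is the diameter of the graph formed by its vertices and edges. Then the combinatorial diameter of $\mathrm{PP}(\kappa_1,\dots,\kappa_n)$ is at most $$\kappa_1+\left\lceil \kappa_2/2\right\rceil,$$ and consequently at most $\lceil 3\kappa_1/2\rceil$. -/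

import Mathlib

/-- The edge graph (1-skeleton) of a polytope `P`. Its nodes are the vertices (extreme points)
of `P`; two distinct vertices are adjacent when the segment joining them is a face of `P`,
that is, the set of maximizers over `P` of some linear functional. -/
def polytopeGraph {E : Type*} [AddCommGroup E] [Module ℝ E] [TopologicalSpace E] (P : Set E) :
    SimpleGraph (P.extremePoints ℝ) where
  Adj u v := u ≠ v ∧ IsExposed ℝ P (segment ℝ (u : E) (v : E))
  symm := ⟨fun u v h => ⟨h.1.symm, by rw [segment_symm]; exact h.2⟩⟩
  loopless := ⟨fun _ h => h.1 rfl⟩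

/-- The combinatorial diameter of a polytope: the diameter of its edge graph, in `ℕ∞`
(it is `⊤` for a disconnected graph). -/
noncomputable def combinatorialDiameter {E : Type*} [AddCommGroup E] [Module ℝ E]
    [TopologicalSpace E] (P : Set E) : ℕ∞ :=
  (polytopeGraph P).ediam

/-- The partition polytope `PP(κ₁, …, κₙ)` for `m` items and `n` clusters of sizes `κ i`:
the real `n × m` arrays `y` with nonnegative entries, `i`-th row sum `κ i`, and all column
sums `1`. -/
def partitionPolytope {n : ℕ} (m : ℕ) (κ : Fin n → ℕ) : Set (Fin n → Fin m → ℝ) :=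
  {y | (∀ i, ∑ j, y i j = (κ i : ℝ)) ∧ (∀ j, ∑ i, y i j = 1) ∧ ∀ i j, 0 ≤ y i j}

/-- `clusterSize κ k` is the `k`-th cluster size, counted from `1`, i.e. the `κ_k` of the usual
notation `κ_1, …, κ_n`; it is `0` when there is no `k`-th cluster. -/
def clusterSize {n : ℕ} (κ : Fin n → ℕ) (k : ℕ) : ℕ :=
  if h : 1 ≤ k ∧ k ≤ n then κ ⟨k - 1, by omega⟩ else 0

/-! By Birkhoff's theorem, vertices of the polytope are clusterings `f : J → V`. Comparing `f` with
a target `g` gives a directed multigraph on the clusters: item `j` is an arc from `f j` to `g j`,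
balanced at every cluster. Moving one item along each arc of a single directed cycle is an edge of
the polytope or trivial, so it suffices to count such cyclic exchanges.

If at most `k` items leave each cluster, Birkhoff's theorem applied to the arc counts, padded on the
diagonal, yields a permutation layer: vertex-disjoint cycles of arcs covering every cluster of
degree `k`. Removing it lowers the maximum degree.

A layer `σ` costs two exchanges. Let `ρ` cycle through one representative per nontrivial orbit of
`σ`. Then `ρ * σ` is one cycle on the clusters moved by `σ`, and the misplaced items are repaired by
the cycle `ρ⁻¹`. Two layers `σ`, `τ` cost only three: with disjoint representative sets, obtained
from Hall's theorem, the repair of `σ` and the preparation of `τ` merge into one cycle by a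
transposition, whose two misplaced items are absorbed by the last exchange. Degree `k` thus costs `k
+ ⌈k/2⌉`.

Only the largest cluster can have degree above `κ₂`. Each unit of excess costs one exchange, along
the cycle of a layer through that cluster. The total is `(κ₁ - κ₂) + κ₂ + ⌈κ₂/2⌉`. -/

/-! ### Merging the orbits of a permutation into one cycle -/

open Equiv.Perm in
theorem Equiv.Perm.SameCycle.mem_of_mapsTo {V : Type*} [Finite V] {σ : Equiv.Perm V} {X : Set V}
    (hX : Set.MapsTo σ X X) {x y : V} (h : σ.SameCycle x y) (hx : x ∈ X) : y ∈ X := by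
  obtain ⟨i, -, rfl⟩ := h.exists_pow_eq'
  rw [← iterate_eq_pow]
  exact hX.iterate i hx

theorem Equiv.Perm.IsCycleOn.congr {V : Type*} [Finite V] {f g : Equiv.Perm V} {X : Set V}
    (hf : f.IsCycleOn X) (h : Set.EqOn f g X) : g.IsCycleOn X := by
  refine ⟨hf.1.congr h, fun x hx y hy => ?_⟩
  obtain ⟨i, -, rfl⟩ := (hf.2 hx hy).exists_pow_eq'
  have key : ∀ i : ℕ, (f ^ i) x ∈ X ∧ (g ^ i) x = (f ^ i) x := by
    intro i
    induction i with
    | zero => simpa using hx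
    | succ i ih =>
      rw [pow_succ', pow_succ', Equiv.Perm.mul_apply, Equiv.Perm.mul_apply, ih.2]
      exact ⟨hf.1.1 ih.1, (h ih.1).symm⟩
  exact ⟨i, by simpa using (key i).2⟩

/-- `R` contains exactly one point of each orbit of `σ` that meets `X`. -/
structure Equiv.Perm.IsTransversal {V : Type*} (σ : Equiv.Perm V) (X R : Set V) : Prop where
  subset : R ⊆ X
  cover : ∀ x ∈ X, ∃ r ∈ R, σ.SameCycle x r
  unique : ∀ r ∈ R, ∀ r' ∈ R, σ.SameCycle r r' → r = r'

namespace Equiv.Perm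

variable {V : Type*}

theorem IsTransversal.inv {σ : Perm V} {X R : Set V} (h : σ.IsTransversal X R) :
    σ⁻¹.IsTransversal X R :=
  ⟨h.subset, by simpa using h.cover, by simpa using h.unique⟩

/-- Composing with a cycle through a transversal merges all orbits into one. -/
theorem IsTransversal.isCycleOn_mul [Finite V] {σ ρ : Perm V} {X R : Set V}
    (h : σ.IsTransversal X R) (hX : Set.MapsTo σ X X) (hρ : ρ.IsCycleOn R)
    (hfix : ∀ x ∉ R, ρ x = x) : (ρ * σ).IsCycleOn X := by
  have hρX : Set.MapsTo ρ X X := fun x hx => by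
    by_cases hxR : x ∈ R
    · exact h.subset (hρ.1.1 hxR)
    · rwa [hfix x hxR]
  have hmaps : Set.MapsTo (ρ * σ) X X := fun x hx => hρX (hX hx)
  -- Outside `R` the product follows `σ`; on arriving at the representative `r` it is diverted to `ρ
  -- r`, hence into the next orbit. The exponent `i + 1` makes a start at `r` itself run once around
  -- its orbit.
  have reach : ∀ i : ℕ, ∀ x ∈ X, ∀ r ∈ R, (σ ^ (i + 1)) x = r →
      (ρ * σ).SameCycle x (ρ r) := by
    intro i
    induction i with
    | zero =>
      rintro x hx r hr rfl
      exact ⟨1, by simp⟩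
    | succ i ih =>
      intro x hx r hr hxr
      by_cases hs : σ x ∈ R
      · have : σ x = r := h.unique _ hs _ hr ⟨(i + 1 : ℕ), by
          rw [zpow_natCast, ← mul_apply, ← pow_succ, hxr]⟩
        exact ⟨1, by simp [this]⟩
      · have h1 := ih (σ x) (hX hx) r hr (by rw [← mul_apply, ← pow_succ, hxr])
        refine SameCycle.trans ⟨1, ?_⟩ h1
        simp [hfix _ hs]
  have reach' : ∀ x ∈ X, ∀ r ∈ R, σ.SameCycle x r → (ρ * σ).SameCycle x (ρ r) := by
    intro x hx r hr hxr
    obtain ⟨i, hi, -, hi'⟩ := hxr.exists_pow_eq''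
    obtain ⟨k, rfl⟩ := Nat.exists_eq_succ_of_ne_zero hi.ne'
    exact reach k x hx r hr hi'
  have hR : ∀ i : ℕ, ∀ r ∈ R, (ρ ^ i) r ∈ R ∧ (ρ * σ).SameCycle r ((ρ ^ i) r) := by
    intro i r hr
    induction i with
    | zero => exact ⟨hr, SameCycle.refl _ _⟩
    | succ i ih =>
      rw [pow_succ', mul_apply]
      exact ⟨hρ.1.1 ih.1, ih.2.trans (reach' _ (h.subset ih.1) _ ih.1 (SameCycle.refl _ _))⟩
  refine ⟨((Set.toFinite X).injOn_iff_bijOn_of_mapsTo hmaps).1 (ρ * σ).injective.injOn, ?_⟩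
  have toR : ∀ x ∈ X, ∃ r ∈ R, (ρ * σ).SameCycle x r := fun x hx => by
    obtain ⟨r, hr, hxr⟩ := h.cover x hx
    exact ⟨ρ r, hρ.1.1 hr, reach' x hx r hr hxr⟩
  intro x hx y hy
  obtain ⟨r, hr, hxr⟩ := toR x hx
  obtain ⟨r', hr', hyr'⟩ := toR y hy
  obtain ⟨i, -, hi⟩ := (hρ.2 hr hr').exists_pow_eq'
  exact hxr.trans ((hi ▸ (hR i r hr).2).trans hyr'.symm)

/-- `R` is also a transversal for `σ⁻¹`, and `σ * ρ⁻¹` is the inverse of `ρ * σ⁻¹`. -/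
theorem IsTransversal.isCycleOn_mul_inv [Finite V] {σ ρ : Perm V} {X R : Set V}
    (h : σ.IsTransversal X R) (hX : Set.MapsTo σ X X) (hρ : ρ.IsCycleOn R)
    (hfix : ∀ x ∉ R, ρ x = x) : (σ * ρ⁻¹).IsCycleOn X := by
  have hbij := ((Set.toFinite X).injOn_iff_bijOn_of_mapsTo hX).1 σ.injective.injOn
  have := (h.inv.isCycleOn_mul (Set.BijOn.perm_inv hbij).1 hρ hfix).inv
  simpa using this

/-- Two disjoint cycles are joined into one by a transposition. -/
theorem IsCycleOn.swap_mul_union [Finite V] [DecidableEq V] {f : Perm V} {P Q : Set V}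
    (hP : f.IsCycleOn P) (hQ : f.IsCycleOn Q) (hd : _root_.Disjoint P Q) {p q : V} (hp : p ∈ P)
    (hq : q ∈ Q) : (swap p q * f).IsCycleOn (P ∪ Q) := by
  have hpq : p ≠ q := fun h => Set.disjoint_left.1 hd hp (h ▸ hq)
  refine IsTransversal.isCycleOn_mul (R := {p, q}) ⟨?_, ?_, ?_⟩ ?_ (isCycleOn_swap hpq) ?_
  · rintro x (rfl | rfl)
    · exact .inl hp
    · exact .inr hq
  · rintro x (hx | hx)
    · exact ⟨p, by simp, hP.2 hx hp⟩
    · exact ⟨q, by simp, hQ.2 hx hq⟩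
  · rintro r (rfl | rfl) r' (rfl | rfl) h
    · rfl
    · exact (Set.disjoint_left.1 hd (h.mem_of_mapsTo hP.1.1 hp) hq).elim
    · exact (Set.disjoint_left.1 hd hp (h.mem_of_mapsTo hQ.1.1 hq)).elim
    · rfl
  · rintro x (hx | hx)
    · exact .inl (hP.1.1 hx)
    · exact .inr (hQ.1.1 hx)
  · intro x hx
    simp only [Set.mem_insert_iff, Set.mem_singleton_iff, not_or] at hx
    exact swap_apply_of_ne_of_ne hx.1 hx.2

/-- The representative of one orbit may be chosen freely. This later makes the two merged cycles
meet at a suitable cluster. -/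
theorem IsTransversal.exchange {σ : Perm V} {X R : Set V} (h : σ.IsTransversal X R) {v : V}
    (hv : v ∈ X) : σ.IsTransversal X (insert v {r ∈ R | ¬ σ.SameCycle v r}) := by
  refine ⟨?_, ?_, ?_⟩
  · rintro x (rfl | hx)
    · exact hv
    · exact h.subset hx.1
  · intro x hx
    by_cases hvx : σ.SameCycle v x
    · exact ⟨v, by simp, hvx.symm⟩
    · obtain ⟨r, hr, hxr⟩ := h.cover x hx
      exact ⟨r, .inr ⟨hr, fun hvr => hvx (hvr.trans hxr.symm)⟩, hxr⟩
  · rintro r (rfl | hr) r' (rfl | hr') hrr'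
    · rfl
    · exact (hr'.2 hrr').elim
    · exact (hr.2 hrr'.symm).elim
    · exact h.unique _ hr.1 _ hr'.1 hrr'

/-- The nontrivial cycles of two permutations have disjoint systems of representatives. -/
theorem exists_disjoint_isTransversal [Finite V] (σ τ : Perm V) :
    ∃ R S : Set V, _root_.Disjoint R S ∧ σ.IsTransversal {x | σ x ≠ x} R ∧
      τ.IsTransversal {x | τ x ≠ x} S := by
  classical
  cases nonempty_fintype V
  let t : σ.cycleFactorsFinset ⊕ τ.cycleFactorsFinset → Finset V :=
    Sum.elim (fun c => c.1.support) (fun c => c.1.support)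
  have htwo : ∀ i, 2 ≤ (t i).card := by
    rintro (⟨c, hc⟩ | ⟨c, hc⟩)
    · exact (mem_cycleFactorsFinset_iff.1 hc).1.two_le_card_support
    · exact (mem_cycleFactorsFinset_iff.1 hc).1.two_le_card_support
  have huniq : ∀ π : Perm V, ∀ v, ∀ c ∈ π.cycleFactorsFinset, v ∈ c.support →
      c = π.cycleOf v := fun π v c hc hv => cycle_is_cycleOf hv hc
  have hcount : ∀ (v : V) (A : Finset (σ.cycleFactorsFinset ⊕ τ.cycleFactorsFinset)),
      (A.filter fun i => v ∈ t i).card ≤ 2 := by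
    intro v A
    rw [← Finset.card_toLeft_add_card_toRight]
    refine Nat.add_le_add (Finset.card_le_one.2 ?_) (Finset.card_le_one.2 ?_)
    · intro a ha b hb
      simp only [Finset.mem_toLeft, Finset.mem_filter, t, Sum.elim_inl] at ha hb
      exact Subtype.ext ((huniq σ v a a.2 ha.2).trans (huniq σ v b b.2 hb.2).symm)
    · intro a ha b hb
      simp only [Finset.mem_toRight, Finset.mem_filter, t, Sum.elim_inr] at ha hb
      exact Subtype.ext ((huniq τ v a a.2 ha.2).trans (huniq τ v b b.2 hb.2).symm)
  -- Hall's condition by double counting: a nontrivial cycle has at least two points, and a point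
  -- lies on at most one cycle of each permutation.
  have hhall : ∀ A : Finset (σ.cycleFactorsFinset ⊕ τ.cycleFactorsFinset),
      A.card ≤ (A.biUnion t).card := by
    intro A
    have h := Finset.card_mul_le_card_mul (s := A) (t := A.biUnion t) (m := 2) (n := 2)
      (fun i v => v ∈ t i) (fun i hi => ?_) (fun v _ => hcount v A)
    · omega
    · refine (htwo i).trans (Finset.card_le_card fun v hv => ?_)
      simp only [Finset.mem_bipartiteAbove, Finset.mem_biUnion]
      exact ⟨⟨i, hi, hv⟩, hv⟩
  obtain ⟨F, hF, hFt⟩ := (Finset.all_card_le_biUnion_card_iff_exists_injective t).1 hhall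
  have trans : ∀ (π : Perm V) (G : π.cycleFactorsFinset → V), (∀ c, G c ∈ c.1.support) →
      π.IsTransversal {x | π x ≠ x} (Set.range G) := by
    intro π G hG
    refine ⟨?_, ?_, ?_⟩
    · rintro _ ⟨c, rfl⟩
      exact mem_support.1 (mem_cycleFactorsFinset_support_le c.2 (hG c))
    · intro x hx
      have hc : π.cycleOf x ∈ π.cycleFactorsFinset :=
        cycleOf_mem_cycleFactorsFinset_iff.2 (mem_support.2 hx)
      exact ⟨_, ⟨⟨_, hc⟩, rfl⟩, (mem_support_cycleOf_iff.1 (hG ⟨_, hc⟩)).1⟩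
    · rintro _ ⟨c, rfl⟩ _ ⟨d, rfl⟩ h
      congr 1
      refine Subtype.ext ?_
      rw [huniq π _ c c.2 (hG c), huniq π _ d d.2 (hG d), h.cycleOf_eq]
  refine ⟨_, _, ?_, trans σ (fun c => F (.inl c)) fun c => hFt (.inl c),
    trans τ (fun c => F (.inr c)) fun c => hFt (.inr c)⟩
  rw [Set.disjoint_left]
  rintro _ ⟨c, rfl⟩ ⟨d, hd⟩
  exact Sum.inl_ne_inr (hF hd.symm)

theorem exists_isCycleOn [Finite V] (R : Set V) :
    ∃ ρ : Perm V, ρ.IsCycleOn R ∧ ∀ x ∉ R, ρ x = x := by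
  obtain ⟨ρ, h, h'⟩ := (Set.toFinite R).countable.exists_cycleOn
  exact ⟨ρ, h, fun x hx => by_contra fun hn => hx (h' hn)⟩

end Equiv.Perm

/-! ### Cyclic exchanges and permutation layers -/

open Equiv in
/-- `g` arises from the clustering `f` by moving, for every cluster `v ∈ Y`, the item `t v` of
cluster `v` to the cluster `c v`, where `c` permutes `Y` cyclically. -/
def CyclicExchange {V J : Type*} (f g : J → V) : Prop :=
  ∃ (c : Perm V) (Y : Set V) (t : V → J), c.IsCycleOn Y ∧
    (∀ v ∈ Y, f (t v) = v ∧ g (t v) = c v) ∧ ∀ j, (∀ v ∈ Y, j ≠ t v) → g j = f j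

/-- `g` is reached from `f` by `k` cyclic exchanges. -/
def ReachIn {V J : Type*} : ℕ → (J → V) → (J → V) → Prop
  | 0, f, g => f = g
  | k + 1, f, g => ∃ h, CyclicExchange f h ∧ ReachIn k h g

section
variable {V J : Type*}

/-- The empty cycle is allowed, so `ReachIn k` amounts to "at most `k` exchanges". A choice of items
`V → J` must exist even when no item moves. -/
theorem CyclicExchange.refl (f : J → V) (c : Equiv.Perm V) [Nonempty (V → J)] :
    CyclicExchange f f :=
  ⟨c, ∅, Classical.arbitrary _, by simp, by simp, fun _ _ => rfl⟩

theorem ReachIn.trans {k l : ℕ} {f g h : J → V} (h₁ : ReachIn k f g) (h₂ : ReachIn l g h) :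
    ReachIn (k + l) f h := by
  induction k generalizing f with
  | zero => obtain rfl : f = g := h₁; simpa using h₂
  | succ k ih =>
    obtain ⟨f', hf, hf'⟩ := h₁
    rw [Nat.succ_add]
    exact ⟨f', hf, ih hf'⟩

theorem CyclicExchange.reachIn {f g : J → V} (h : CyclicExchange f g) : ReachIn 1 f g :=
  ⟨g, h, rfl⟩

theorem ReachIn.refl [Nonempty (V → J)] (k : ℕ) (f : J → V) : ReachIn k f f := by
  induction k with
  | zero => rfl
  | succ k ih => exact ⟨f, .refl f 1, ih⟩

theorem ReachIn.mono [Nonempty (V → J)] {k l : ℕ} (hkl : k ≤ l) {f g : J → V}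
    (h : ReachIn k f g) : ReachIn l f g := by
  obtain ⟨d, rfl⟩ := Nat.exists_eq_add_of_le hkl
  exact h.trans (.refl d g)

open Equiv

/-- The clustering obtained by applying a cyclic exchange. -/
theorem exists_cyclicExchange {f : J → V} {c : Perm V} {Y : Set V} {t : V → J}
    (hc : c.IsCycleOn Y) (ht : ∀ v ∈ Y, f (t v) = v) :
    ∃ g, CyclicExchange f g ∧ (∀ v ∈ Y, g (t v) = c v) ∧
      ∀ j, (∀ v ∈ Y, j ≠ t v) → g j = f j := by
  classical
  let g : J → V := fun j => if ∃ v ∈ Y, j = t v then c (f j) else f j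
  have h₁ : ∀ v ∈ Y, g (t v) = c v := fun v hv => by
    simp only [g, if_pos (show ∃ w ∈ Y, t v = t w from ⟨v, hv, rfl⟩), ht v hv]
  have h₂ : ∀ j, (∀ v ∈ Y, j ≠ t v) → g j = f j := fun j hj => by
    simp only [g]
    rw [if_neg]
    rintro ⟨v, hv, h⟩
    exact hj v hv h
  exact ⟨g, ⟨c, Y, t, hc, fun v hv => ⟨ht v hv, h₁ v hv⟩, h₂⟩, h₁, h₂⟩

/-- `σ` moves the items `s v` of `f` towards `h`. -/
structure IsLayer (σ : Perm V) (s : V → J) (f h : J → V) : Prop where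
  source : ∀ v, σ v ≠ v → f (s v) = v
  target : ∀ v, σ v ≠ v → h (s v) = σ v

/-- The clustering obtained by moving the items of a layer. -/
theorem IsLayer.exists_moved {σ : Perm V} {s : V → J} {f g : J → V} (hl : IsLayer σ s f g) :
    ∃ h, IsLayer σ s f h ∧ ∀ j, (∀ v, σ v ≠ v → j ≠ s v) → h j = f j := by
  classical
  let h : J → V := fun j => if ∃ v, σ v ≠ v ∧ j = s v then g j else f j
  refine ⟨h, ⟨hl.source, fun v hv => ?_⟩, fun j hj => ?_⟩
  · simp only [h]
    rw [if_pos ⟨v, hv, rfl⟩, hl.target v hv]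
  · simp only [h]
    rw [if_neg]
    rintro ⟨v, hv, h'⟩
    exact hj v hv h'

theorem Equiv.Perm.apply_inv_cancel (σ : Perm V) (x : V) : σ (σ⁻¹ x) = x :=
  σ.apply_symm_apply x

theorem Equiv.Perm.inv_apply_cancel (σ : Perm V) (x : V) : σ⁻¹ (σ x) = x :=
  σ.symm_apply_apply x

theorem mapsTo_moved (σ : Perm V) : Set.MapsTo σ {x | σ x ≠ x} {x | σ x ≠ x} :=
  fun _ hx h => hx (σ.injective h)

/-- A permutation layer takes two cyclic exchanges. -/
theorem IsLayer.reachIn_two [Finite V] {σ : Perm V} {s : V → J} {f h : J → V}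
    (hl : IsLayer σ s f h) (hrest : ∀ j, (∀ v, σ v ≠ v → j ≠ s v) → h j = f j) :
    ReachIn 2 f h := by
  obtain ⟨R, -, -, hR, -⟩ := Equiv.Perm.exists_disjoint_isTransversal σ σ
  obtain ⟨ρ, hρ, hfix⟩ := Equiv.Perm.exists_isCycleOn R
  have hA := hR.isCycleOn_mul (mapsTo_moved σ) hρ hfix
  obtain ⟨f₁, hf₁, h₁, h₁'⟩ := exists_cyclicExchange (f := f) (t := s) hA hl.source
  refine ⟨f₁, hf₁, h, ?_, rfl⟩
  have hR' : ∀ v ∈ R, σ (σ⁻¹ v) ≠ σ⁻¹ v := fun v hv h =>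
    hR.subset hv (by nth_rw 1 [← Perm.apply_inv_cancel σ v, h, Perm.apply_inv_cancel])
  -- The misplaced items are those bound for `R`: the one now in `v ∈ R` was bound for `ρ⁻¹ v`.
  refine ⟨ρ⁻¹, R, fun v => s (σ⁻¹ (ρ⁻¹ v)), hρ.inv, fun v hv => ?_, fun j hj => ?_⟩
  · have := hR' _ (hρ.inv.1.1 hv)
    refine ⟨?_, ?_⟩
    · exact (h₁ _ this).trans (by simp)
    · exact (hl.target _ this).trans (by simp)
  · by_cases hjs : ∃ v, σ v ≠ v ∧ j = s v
    · obtain ⟨v, hv, rfl⟩ := hjs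
      rw [h₁ v hv, hl.target v hv, Perm.mul_apply]
      by_cases hvR : σ v ∈ R
      · exact (hj _ (hρ.1.1 hvR) (by simp)).elim
      · exact (hfix _ hvR).symm
    · push Not at hjs
      rw [hrest j hjs, h₁' j hjs]

/-- Two exchanges realise two permutation layers up to one leftover cycle. -/
theorem exists_reachIn_two_of_layers [Finite V] {σ τ : Perm V} {s t : V → J} {f h : J → V}
    (hσ : IsLayer σ s f h) (hτ : IsLayer τ t f h)
    (hst : ∀ v w, σ v ≠ v → τ w ≠ w → s v ≠ t w) {R S : Set V} {ρ π : Perm V}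
    (hRS : Disjoint R S) (hR : σ.IsTransversal {x | σ x ≠ x} R)
    (hS : τ.IsTransversal {x | τ x ≠ x} S) (hρ : ρ.IsCycleOn R) (hρfix : ∀ x ∉ R, ρ x = x)
    (hπ : π.IsCycleOn S) (hπfix : ∀ x ∉ S, π x = x) {a b : V} (ha : a ∈ R) (hb : b ∈ S) :
    ∃ g, ReachIn 2 f g ∧ (∀ v, σ v ≠ v → σ v ≠ a → g (s v) = σ v) ∧
      g (s (σ⁻¹ a)) = π b ∧ (∀ v, τ v ≠ v → v ≠ b → g (t v) = π v) ∧ g (t b) = a ∧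
      ∀ j, (∀ v, σ v ≠ v → j ≠ s v) → (∀ v, τ v ≠ v → j ≠ t v) → g j = f j := by
  classical
  have hdR : ∀ {x}, x ∈ R → x ∉ S := fun h h' => Set.disjoint_left.1 hRS h h'
  have hdS : ∀ {x}, x ∈ S → x ∉ R := fun h h' => Set.disjoint_left.1 hRS h' h
  have hA := hR.isCycleOn_mul (mapsTo_moved σ) hρ hρfix
  obtain ⟨f₁, hf₁, h₁, h₁'⟩ := exists_cyclicExchange (f := f) (t := s) hA hσ.source
  have hsymm : ∀ v, σ v ≠ v → σ (σ⁻¹ v) ≠ σ⁻¹ v := fun v hv h => by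
    rw [Perm.apply_inv_cancel] at h
    exact hv (by nth_rw 1 [h, Perm.apply_inv_cancel])
  have hρR : ∀ {x}, x ∈ R → ρ⁻¹ x ∈ R := fun h => hρ.inv.1.1 h
  have hπS : ∀ {x}, x ∈ S → π x ∈ S := fun h => hπ.1.1 h
  have hπR : ∀ {x}, x ∉ S → π x = x := fun {x} h => hπfix x h
  have hρi : ∀ {x}, x ∉ R → ρ⁻¹ x = x := fun {x} h => by
    rw [Perm.inv_eq_iff_eq, hρfix x h]
  have hD : (ρ⁻¹ * π).IsCycleOn R := hρ.inv.congr fun x hx => by simp [hπR (hdR hx)]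
  have hE : (ρ⁻¹ * π).IsCycleOn S := hπ.congr fun x hx => by
    rw [Perm.mul_apply, hρi (hdS (hπS hx))]
  -- The second exchange repairs `σ` by `ρ⁻¹` on `R` and prepares `τ` by `π` on `S`. The
  -- transposition joining these cycles interchanges two destinations: the item bound for `a` lands
  -- in `π b`, and `t b` lands in `a`.
  have hB := hD.swap_mul_union hE hRS ha (hπS hb)
  have ht₁ : ∀ w, τ w ≠ w → f₁ (t w) = w := fun w hw => by
    rw [h₁' _ fun v hv => (hst v w hv hw).symm, hτ.source w hw]
  let u : V → J := fun v => if v ∈ R then s (σ⁻¹ (ρ⁻¹ v)) else t v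
  have huR : ∀ v ∈ R, u v = s (σ⁻¹ (ρ⁻¹ v)) := fun v hv => if_pos hv
  have huS : ∀ v ∈ S, u v = t v := fun v hv => if_neg (hdS hv)
  have hu : ∀ v ∈ R ∪ S, f₁ (u v) = v := by
    rintro v (hv | hv)
    · rw [huR v hv, h₁ _ (hsymm _ (hR.subset (hρR hv)))]
      simp
    · rw [huS v hv, ht₁ v (hS.subset hv)]
  obtain ⟨g, hg, h₂, h₂'⟩ := exists_cyclicExchange hB hu
  have hsne : ∀ v, σ v ≠ v → σ v ∉ R → ∀ w ∈ R ∪ S, s v ≠ u w := by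
    rintro v hv hvR w (hw | hw) h
    · rw [huR w hw] at h
      have h' := congrArg f h
      rw [hσ.source _ hv, hσ.source _ (hsymm _ (hR.subset (hρR hw)))] at h'
      exact hvR (by rw [h', Perm.apply_inv_cancel]; exact hρR hw)
    · rw [huS w hw] at h
      exact hst v w hv (hS.subset hw) h
  have htne : ∀ v, τ v ≠ v → v ∉ S → ∀ w ∈ R ∪ S, t v ≠ u w := by
    rintro v hv hvS w (hw | hw) h
    · rw [huR w hw] at h
      exact hst _ v (hsymm _ (hR.subset (hρR hw))) hv h.symm
    · rw [huS w hw] at h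
      have h' := congrArg f h
      rw [hτ.source _ hv, hτ.source _ (hS.subset hw)] at h'
      exact hvS (h' ▸ hw)
  refine ⟨g, ⟨f₁, hf₁, g, hg, rfl⟩, ?_, ?_, ?_, ?_, ?_⟩
  · intro v hv hva
    by_cases hvR : σ v ∈ R
    · have hw : ρ (σ v) ∈ R := hρ.1.1 hvR
      have h3 := h₂ (ρ (σ v)) (.inl hw)
      rw [huR _ hw] at h3
      simp only [Perm.inv_apply_cancel, Perm.mul_apply, hπR (hdR hw)] at h3
      rw [h3, swap_apply_of_ne_of_ne hva]
      exact fun h' => hdR hvR (h' ▸ hπS hb)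
    · rw [h₂' _ (hsne v hv hvR), h₁ v hv, Perm.mul_apply, hρfix _ hvR]
  · have hw : ρ a ∈ R := hρ.1.1 ha
    have h3 := h₂ (ρ a) (.inl hw)
    rw [huR _ hw] at h3
    simpa [hπR (hdR hw)] using h3
  · intro v hv hvb
    by_cases hvS : v ∈ S
    · have h3 := h₂ v (.inr hvS)
      rw [huS _ hvS] at h3
      simp only [Perm.mul_apply, hρi (hdS (hπS hvS))] at h3
      rw [h3, swap_apply_of_ne_of_ne]
      · exact fun h' => hdS (hπS hvS) (h' ▸ ha)
      · exact fun h' => hvb (π.injective h')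
    · rw [h₂' _ (htne v hv hvS), ht₁ v hv, hπR hvS]
  · have h3 := h₂ b (.inr hb)
    rw [huS _ hb] at h3
    simpa [Perm.mul_apply, hρi (hdS (hπS hb))] using h3
  · intro j hj hj'
    rw [h₂', h₁' j hj]
    rintro v (hv | hv)
    · rw [huR v hv]
      exact hj _ (hsymm _ (hR.subset (hρR hv)))
    · rw [huS v hv]
      exact hj' _ (hS.subset hv)

end

/-! ### Two layers in three exchanges -/

open Equiv
section
variable {V J : Type*}

/-- Two permutation layers take three cyclic exchanges. -/
theorem reachIn_three_of_representatives [Finite V] {σ τ : Perm V} {s t : V → J} {f h : J → V}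
    (hσ : IsLayer σ s f h) (hτ : IsLayer τ t f h)
    (hst : ∀ v w, σ v ≠ v → τ w ≠ w → s v ≠ t w)
    (hrest : ∀ j, (∀ v, σ v ≠ v → j ≠ s v) → (∀ v, τ v ≠ v → j ≠ t v) → h j = f j)
    {R S : Set V}
    (hRS : Disjoint R S) (hR : σ.IsTransversal {x | σ x ≠ x} R)
    (hS : τ.IsTransversal {x | τ x ≠ x} S) {a b : V} (ha : a ∈ R) (hb : b ∈ S)
    (hab : τ b = a ∨ τ a = a) : ReachIn 3 f h := by
  classical
  obtain ⟨ρ, hρ, hρfix⟩ := Equiv.Perm.exists_isCycleOn R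
  obtain ⟨π, hπ, hπfix⟩ := Equiv.Perm.exists_isCycleOn S
  obtain ⟨g, hg, hg₁, hg₂, hg₃, hg₄, hg₅⟩ := exists_reachIn_two_of_layers hσ hτ hst hRS hR hS
    hρ hρfix hπ hπfix ha hb
  refine hg.trans (l := 1) (CyclicExchange.reachIn ?_)
  have hC := hS.isCycleOn_mul_inv (mapsTo_moved τ) hπ hπfix
  have hπb : τ (π b) ≠ π b := hS.subset (hπ.1.1 hb)
  have hπm : ∀ v, τ v ≠ v → τ (π v) ≠ π v := fun v hv => by
    by_cases hvS : v ∈ S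
    · exact hS.subset (hπ.1.1 hvS)
    · rwa [hπfix v hvS]
  have hπi : ∀ w, τ w ≠ w → τ (π⁻¹ w) ≠ π⁻¹ w := fun w hw => by
    by_cases hwS : w ∈ S
    · exact hS.subset (hπ.inv.1.1 hwS)
    · rwa [Perm.inv_eq_iff_eq.2 (hπfix w hwS).symm]
  have hσa : σ (σ⁻¹ a) ≠ σ⁻¹ a := fun h' => hR.subset ha (by
    nth_rw 1 [← Perm.apply_inv_cancel σ a, h', Perm.apply_inv_cancel])
  have hha : h (s (σ⁻¹ a)) = a := by rw [hσ.target _ hσa, Perm.apply_inv_cancel]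
  -- Every item outside the third exchange must already be home. The only delicate one is `t b`, now
  -- in `a`: either `a = τ b` is its destination, or it has to be among the moved items.
  have key : ∀ (Y : Set V) (u : V → J), {x | τ x ≠ x} ⊆ Y → u (π b) = s (σ⁻¹ a) →
      (∀ v, τ v ≠ v → v ≠ b → u (π v) = t v) → (τ b = a ∨ ∃ w ∈ Y, u w = t b) →
      ∀ j, (∀ v ∈ Y, j ≠ u v) → h j = g j := by
    intro Y u hY hub hu hub' j hj
    by_cases hjs : ∃ v, σ v ≠ v ∧ j = s v
    · obtain ⟨v, hv, rfl⟩ := hjs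
      by_cases hva : σ v = a
      · obtain rfl : v = σ⁻¹ a := by rw [← hva, Perm.inv_apply_cancel]
        exact (hj _ (hY hπb) hub.symm).elim
      · rw [hσ.target v hv, hg₁ v hv hva]
    by_cases hjt : ∃ v, τ v ≠ v ∧ j = t v
    · obtain ⟨v, hv, rfl⟩ := hjt
      by_cases hvb : v = b
      · subst hvb
        rcases hub' with h' | ⟨w, hw, h'⟩
        · rw [hg₄, hτ.target v hv, h']
        · exact (hj w hw h'.symm).elim
      · exact (hj _ (hY (hπm v hv)) (hu v hv hvb).symm).elim
    push Not at hjs hjt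
    rw [hrest j hjs hjt, hg₅ j hjs hjt]
  have other : ∀ w, τ w ≠ w → w ≠ π b →
      g (t (π⁻¹ w)) = w ∧ h (t (π⁻¹ w)) = τ (π⁻¹ w) := fun w hw hwb => by
    refine ⟨?_, hτ.target _ (hπi w hw)⟩
    rw [hg₃ _ (hπi w hw) fun h' => hwb (by rw [← h', Perm.apply_inv_cancel]),
      Perm.apply_inv_cancel]
  -- Here `t b` is already home, and `τ * π⁻¹` sends the stray item from `π b` to `τ b = a`, which
  -- is its destination.
  by_cases hba : τ b = a
  · let u : V → J := fun w => if w = π b then s (σ⁻¹ a) else t (π⁻¹ w)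
    have hub : u (π b) = s (σ⁻¹ a) := if_pos rfl
    have hu : ∀ w, w ≠ π b → u w = t (π⁻¹ w) := fun w hw => if_neg hw
    refine ⟨τ * π⁻¹, {x | τ x ≠ x}, u, hC, fun w hw => ?_, key _ u subset_rfl hub
      (fun v _ hvb => by rw [hu _ fun h' => hvb (π.injective h'), Perm.inv_apply_cancel])
      (.inl hba)⟩
    by_cases hwb : w = π b
    · subst hwb
      rw [hub, hg₂, hha, Perm.mul_apply, Perm.inv_apply_cancel, hba]
      exact ⟨rfl, rfl⟩
    · rw [hu w hwb]
      exact other w hw hwb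
  · have hτa := hab.resolve_left hba
    have haS : a ∉ S := fun h' => hS.subset h' hτa
    have hπa : π⁻¹ a = a := Perm.inv_eq_iff_eq.2 (hπfix a haS).symm
    have hab' : a ≠ π b := fun h' => hπb (h' ▸ hτa)
    have hτb : τ b ≠ b := hS.subset hb
    -- Since `τ` fixes `a`, this cluster can be inserted into the cycle `τ * π⁻¹` between `π b` and
    -- `τ b`: the stray item goes from `π b` to `a`, while `t b` goes from `a` to `τ b`.
    let u : V → J := fun w => if w = π b then s (σ⁻¹ a) else if w = a then t b else t (π⁻¹ w)
    have hub : u (π b) = s (σ⁻¹ a) := if_pos rfl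
    have hua : u a = t b := by simp only [u, if_neg hab', if_true]
    have hu : ∀ w, w ≠ π b → w ≠ a → u w = t (π⁻¹ w) := fun w hw hw' => by
      simp only [u, if_neg hw, if_neg hw']
    have hD : (τ * π⁻¹).IsCycleOn {a} := by
      rw [Perm.isCycleOn_singleton, Perm.mul_apply, hπa, hτa]
    have hE := hD.swap_mul_union hC
      (Set.disjoint_singleton_left.2 fun h' => h' hτa) (Set.mem_singleton a)
      (mapsTo_moved τ hτb)
    refine ⟨_, _, u, hE, ?_, key _ u Set.subset_union_right hub (fun v hv hvb => ?_)
      (.inr ⟨a, by simp, hua⟩)⟩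
    · have hw_a : ∀ w ∈ {x | τ x ≠ x}, w ≠ a := fun w hw h' => hw (h' ▸ hτa)
      rintro w (rfl | hw)
      · rw [hua, hg₄, hτ.target b hτb, Perm.mul_apply, Perm.mul_apply, hπa, hτa,
          swap_apply_left]
        exact ⟨rfl, rfl⟩
      by_cases hwb : w = π b
      · subst hwb
        rw [hub, hg₂, hha, Perm.mul_apply, Perm.mul_apply, Perm.inv_apply_cancel,
          swap_apply_right]
        exact ⟨rfl, rfl⟩
      · rw [hu w hwb (hw_a w hw), Perm.mul_apply, Perm.mul_apply,
          swap_apply_of_ne_of_ne (fun h' => hw_a _ (mapsTo_moved τ (hπi w hw)) h')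
            (fun h' => hwb (by rw [← τ.injective h', Perm.apply_inv_cancel]))]
        exact other w hw hwb
    · rw [hu _ (fun h' => hvb (π.injective h')) (fun h' => hπm v hv (h' ▸ hτa)),
        Perm.inv_apply_cancel]

/-- Suitable `a` and `b` always exist after possibly interchanging the layers; the two cases depend
on whether `σ` moves everything that `τ` moves. -/
theorem reachIn_three_of_layers [Finite V] {σ τ : Perm V} {s t : V → J} {f h : J → V}
    (hσ : IsLayer σ s f h) (hτ : IsLayer τ t f h)
    (hst : ∀ v w, σ v ≠ v → τ w ≠ w → s v ≠ t w)
    (hrest : ∀ j, (∀ v, σ v ≠ v → j ≠ s v) → (∀ v, τ v ≠ v → j ≠ t v) → h j = f j) :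
    ReachIn 3 f h := by
  have hne : Nonempty (V → J) := ⟨s⟩
  by_cases hσ1 : ∀ v, σ v = v
  · exact (hτ.reachIn_two fun j hj => hrest j (fun v hv => (hv (hσ1 v)).elim) hj).mono (by simp)
  by_cases hτ1 : ∀ v, τ v = v
  · exact (hσ.reachIn_two fun j hj => hrest j hj (fun v hv => (hv (hτ1 v)).elim)).mono (by simp)
  push Not at hσ1 hτ1
  obtain ⟨R, S, hRS, hR, hS⟩ := Equiv.Perm.exists_disjoint_isTransversal σ τ
  by_cases hsub : ∀ v, τ v ≠ v → σ v ≠ v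
  · obtain ⟨x, hx⟩ := hτ1
    obtain ⟨b, hb, -⟩ := hS.cover x hx
    have hbm : τ b ≠ b := hS.subset hb
    refine reachIn_three_of_representatives hσ hτ hst hrest ?_
      -- Take `a = τ b`. It is not in `S`, because its orbit under `τ` is already represented by `b
      -- ≠ τ b`.
      (hR.exchange (v := τ b) (hsub _ (mapsTo_moved τ hbm))) hS (Set.mem_insert _ _) hb (.inl rfl)
    rw [Set.disjoint_insert_left]
    exact ⟨fun h' => hbm (hS.unique _ h' _ hb ⟨-1, by simp⟩), hRS.mono_left (Set.sep_subset _ _)⟩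
  · push Not at hsub
    obtain ⟨a, ha, hσa⟩ := hsub
    obtain ⟨x, hx⟩ := hσ1
    obtain ⟨b, hb, -⟩ := hR.cover x hx
    -- The layers change roles: `a` is moved by `τ` and fixed by `σ`, so it can represent its
    -- `τ`-orbit and avoids `R`.
    refine reachIn_three_of_representatives hτ hσ (fun v w hv hw h' => hst w v hw hv h'.symm)
      (fun j hj hj' => hrest j hj' hj) ?_
      (hS.exchange ha) hR (Set.mem_insert _ _) hb (.inr hσa)
    rw [Set.disjoint_insert_left]
    exact ⟨fun h' => hR.subset h' hσa, hRS.symm.mono_left (Set.sep_subset _ _)⟩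

end

/-! ### Peeling layers off the difference of two clusterings -/

open Equiv
section
variable {V J : Type*} [Fintype J] [DecidableEq V]

/-- The number of items of cluster `v` of `f` that `g` puts elsewhere. -/
def moveDegree (f g : J → V) (v : V) : ℕ :=
  (Finset.univ.filter fun j => f j = v ∧ g j ≠ v).card

theorem eq_of_moveDegree_eq_zero {f g : J → V} (h : ∀ v, moveDegree f g v = 0) : f = g := by
  funext j
  by_contra hj
  have := h (f j)
  simp only [moveDegree, Finset.card_eq_zero, Finset.filter_eq_empty_iff] at this
  exact this (Finset.mem_univ j) ⟨rfl, fun h' => hj h'.symm⟩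

theorem CyclicExchange.card_fiber {f g : J → V} (h : CyclicExchange f g) (v : V) :
    (Finset.univ.filter fun j => g j = v).card = (Finset.univ.filter fun j => f j = v).card := by
  classical
  obtain ⟨c, Y, t, hc, ht, hrest⟩ := h
  by_cases hv : v ∈ Y
  · obtain ⟨u, hu, rfl⟩ := hc.1.2.2 hv
    have hmem : t (c u) ∈ Finset.univ.filter fun j => f j = c u := by simpa using (ht _ hv).1
    have hg : (Finset.univ.filter fun j => g j = c u) =
        insert (t u) ((Finset.univ.filter fun j => f j = c u).erase (t (c u))) := by
      ext j
      simp only [Finset.mem_filter, Finset.mem_univ, true_and, Finset.mem_insert,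
        Finset.mem_erase]
      by_cases hj : ∃ w ∈ Y, j = t w
      · obtain ⟨w, hw, rfl⟩ := hj
        rw [(ht w hw).1, (ht w hw).2]
        constructor
        · intro h'
          exact .inl (by rw [c.injective h'])
        · rintro (h' | ⟨h', h''⟩)
          · have := congrArg f h'
            rw [(ht w hw).1, (ht u hu).1] at this
            rw [this]
          · exact (h' (by rw [h''])).elim
      · push Not at hj
        rw [hrest j hj]
        simp [hj u hu, hj _ hv]
    rw [hg, Finset.card_insert_of_notMem, Finset.card_erase_add_one hmem]
    simp only [Finset.mem_erase, Finset.mem_filter, Finset.mem_univ, true_and, (ht u hu).1]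
    rintro ⟨h1, h2⟩
    exact h1 (by rw [← h2])
  · congr 1
    ext j
    simp only [Finset.mem_filter, Finset.mem_univ, true_and]
    by_cases hj : ∃ w ∈ Y, j = t w
    · obtain ⟨w, hw, rfl⟩ := hj
      rw [(ht w hw).1, (ht w hw).2]
      exact ⟨fun h' => (hv (h' ▸ hc.1.1 hw)).elim, fun h' => (hv (h' ▸ hw)).elim⟩
    · push Not at hj
      rw [hrest j hj]

theorem ReachIn.card_fiber {k : ℕ} {f g : J → V} (h : ReachIn k f g) (v : V) :
    (Finset.univ.filter fun j => g j = v).card = (Finset.univ.filter fun j => f j = v).card := by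
  induction k generalizing f with
  | zero => obtain rfl : f = g := h; rfl
  | succ k ih =>
    obtain ⟨f', hf, hf'⟩ := h
    rw [ih hf', hf.card_fiber]

/-- If at most `k` items leave each cluster, then some permutation layer meets every cluster that
exactly `k` items leave. -/
theorem exists_isLayer [Fintype V] [Nonempty (V → J)] {f g : J → V} {k : ℕ} (hk : 0 < k)
    (hfib : ∀ v, (Finset.univ.filter fun j => g j = v).card =
      (Finset.univ.filter fun j => f j = v).card) (hdeg : ∀ v, moveDegree f g v ≤ k) :
    ∃ (σ : Perm V) (s : V → J), IsLayer σ s f g ∧ ∀ v, moveDegree f g v = k → σ v ≠ v := by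
  classical
  obtain ⟨s₀⟩ := ‹Nonempty (V → J)›
  let N : V → V → ℕ := fun u v => (Finset.univ.filter fun j => f j = u ∧ g j = v).card
  let F : V → ℕ := fun v => (Finset.univ.filter fun j => f j = v).card
  have hNrow : ∀ u, ∑ v, N u v = F u := fun u => by
    simp only [N, F]
    rw [Finset.card_eq_sum_card_fiberwise (f := g) (t := Finset.univ) (by simp)]
    simp only [Finset.filter_filter]
  have hNcol : ∀ v, ∑ u, N u v = F v := fun v => by
    simp only [N, F]
    rw [← hfib, Finset.card_eq_sum_card_fiberwise (f := f) (t := Finset.univ) (by simp)]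
    simp only [Finset.filter_filter, and_comm]
  have hdiag : ∀ v, N v v + moveDegree f g v = F v := fun v => by
    simp only [N, F, moveDegree]
    rw [← Finset.card_filter_add_card_filter_not (s := Finset.univ.filter fun j => f j = v)
      (p := fun j => g j = v)]
    simp only [Finset.filter_filter]
  have hkR : (0 : ℝ) < k := by exact_mod_cast hk
  -- The correction makes all row and column sums `1` and the diagonal entries `(k - moveDegree f g
  -- v) / k`. A permutation in the support of `M` therefore uses actual arcs off the diagonal and
  -- cannot fix a cluster of degree `k`.
  let M : Matrix V V ℝ := fun u v => ((N u v : ℝ) + if u = v then (k : ℝ) - F u else 0) / k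
  have hMdiag : ∀ v, M v v = (k - moveDegree f g v : ℝ) / k := fun v => by
    have : (N v v : ℝ) + moveDegree f g v = F v := by exact_mod_cast hdiag v
    simp only [M, if_true, ← this]
    ring
  have hMoff : ∀ u v, u ≠ v → M u v = N u v / k := fun u v h => by simp [M, h]
  have hM : M ∈ doublyStochastic ℝ V := by
    rw [mem_doublyStochastic_iff_sum]
    refine ⟨fun u v => ?_, fun u => ?_, fun v => ?_⟩
    · by_cases h : u = v
      · subst h
        rw [hMdiag]
        have : (moveDegree f g u : ℝ) ≤ k := by exact_mod_cast hdeg u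
        exact div_nonneg (by linarith) hkR.le
      · rw [hMoff u v h]
        positivity
    · simp only [M]
      rw [← Finset.sum_div, Finset.sum_add_distrib, ← Nat.cast_sum, hNrow]
      simp [hkR.ne']
    · simp only [M]
      rw [← Finset.sum_div, Finset.sum_add_distrib, ← Nat.cast_sum, hNcol]
      simp [hkR.ne']
  obtain ⟨w, hw, hw1, hwM⟩ := exists_eq_sum_perm_of_mem_doublyStochastic hM
  obtain ⟨σ, -, hσ⟩ : ∃ σ ∈ Finset.univ, 0 < w σ := by
    apply Finset.exists_lt_of_sum_lt
    simp [hw1]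
  have hpos : ∀ v, 0 < M v (σ v) := fun v => by
    rw [← hwM, Matrix.sum_apply]
    refine Finset.sum_pos' (fun τ _ => ?_) ⟨σ, Finset.mem_univ _, ?_⟩
    · rw [Matrix.smul_apply, smul_eq_mul]
      refine mul_nonneg (hw τ) ?_
      simp only [Perm.permMatrix, PEquiv.toMatrix_apply]
      split_ifs <;> norm_num
    · simpa [Perm.permMatrix, PEquiv.toMatrix_apply] using hσ
  have hs : ∀ v, ∃ j, σ v ≠ v → f j = v ∧ g j = σ v := fun v => by
    by_cases hv : σ v = v
    · exact ⟨s₀ v, fun h => (h hv).elim⟩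
    · have h := hpos v
      rw [hMoff _ _ (Ne.symm hv), div_pos_iff_of_pos_right hkR, Nat.cast_pos,
        Finset.card_pos] at h
      obtain ⟨j, hj⟩ := h
      exact ⟨j, fun _ => by simpa using hj⟩
  choose s hs using hs
  refine ⟨σ, s, ⟨fun v hv => (hs v hv).1, fun v hv => (hs v hv).2⟩, fun v hv h => ?_⟩
  have h' := hpos v
  rw [h, hMdiag, hv] at h'
  simp at h'

/-- Bringing items of the clusters in `Y` to their destination lowers the degrees there. -/
theorem moveDegree_add_le {f h g : J → V} {Y : Set V} [DecidablePred (· ∈ Y)] {t : V → J}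
    (ht : ∀ v ∈ Y, f (t v) = v ∧ h (t v) = g (t v) ∧ g (t v) ≠ v)
    (hrest : ∀ j, (∀ v ∈ Y, j ≠ t v) → h j = f j) (v : V) :
    moveDegree h g v + (if v ∈ Y then 1 else 0) ≤ moveDegree f g v := by
  classical
  -- The moved items have reached their destination, so an item still to leave `v` is an unmoved
  -- one.
  have hsub : ∀ j, h j = v ∧ g j ≠ v → (f j = v ∧ g j ≠ v) ∧ ∀ w ∈ Y, j ≠ t w := by
    rintro j ⟨h1, h2⟩
    have : ∀ w ∈ Y, j ≠ t w := by
      rintro w hw rfl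
      exact h2 ((ht w hw).2.1 ▸ h1)
    exact ⟨⟨(hrest j this) ▸ h1, h2⟩, this⟩
  split_ifs with hv
  · refine Finset.card_lt_card ⟨fun j hj => ?_, fun hsup => ?_⟩
    · simpa using (hsub j (by simpa using hj)).1
    · have := @hsup (t v) (by simpa using ⟨(ht v hv).1, (ht v hv).2.2⟩)
      exact (hsub _ (by simpa using this)).2 v hv rfl
  · refine Finset.card_le_card fun j hj => ?_
    simpa using (hsub j (by simpa using hj)).1

/-- Moving a layer that meets every cluster of degree `k + 1` lowers the maximum degree. -/
theorem exists_layer_step [Fintype V] [Nonempty (V → J)] {f g : J → V} {k : ℕ}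
    (hfib : ∀ v, (Finset.univ.filter fun j => g j = v).card =
      (Finset.univ.filter fun j => f j = v).card) (hdeg : ∀ v, moveDegree f g v ≤ k + 1) :
    ∃ (σ : Perm V) (s : V → J) (h : J → V), IsLayer σ s f g ∧ IsLayer σ s f h ∧
      (∀ j, (∀ v, σ v ≠ v → j ≠ s v) → h j = f j) ∧ ∀ v, moveDegree h g v ≤ k := by
  classical
  obtain ⟨σ, s, hl, hσ⟩ := exists_isLayer (Nat.succ_pos k) hfib hdeg
  obtain ⟨h, hh, hrest⟩ := hl.exists_moved
  refine ⟨σ, s, h, hl, hh, hrest, fun v => ?_⟩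
  have h1 := moveDegree_add_le (f := f) (h := h) (g := g) (Y := {v | σ v ≠ v}) (t := s)
    (fun v hv => ⟨hl.source v hv, by rw [hh.target v hv, hl.target v hv], by
      rw [hl.target v hv]; exact hv⟩) hrest v
  have h2 := hdeg v
  by_cases hv : σ v = v
  · have : moveDegree f g v ≠ k + 1 := fun h' => hσ v h' hv
    omega
  · rw [if_pos (show v ∈ {v | σ v ≠ v} from hv)] at h1
    omega

/-- Layers are peeled off in pairs at three exchanges each; for odd `k` a last single layer costs
two. -/
theorem reachIn_of_moveDegree_le [Fintype V] [Nonempty (V → J)] (k : ℕ) {f g : J → V}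
    (hfib : ∀ v, (Finset.univ.filter fun j => g j = v).card =
      (Finset.univ.filter fun j => f j = v).card) (hdeg : ∀ v, moveDegree f g v ≤ k) :
    ReachIn (k + (k + 1) / 2) f g := by
  induction k using Nat.twoStepInduction generalizing f with
  | zero => exact eq_of_moveDegree_eq_zero fun v => Nat.le_zero.1 (hdeg v)
  | one =>
    obtain ⟨σ, s, h, -, hh, hrest, hd⟩ := exists_layer_step hfib hdeg
    obtain rfl : h = g := eq_of_moveDegree_eq_zero fun v => Nat.le_zero.1 (hd v)
    exact hh.reachIn_two hrest
  | more k ih _ =>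
    obtain ⟨σ, s, h, hσg, hh, hrest, hd⟩ := exists_layer_step hfib hdeg
    have hfib' := fun v => (hfib v).trans ((hh.reachIn_two hrest).card_fiber v).symm
    obtain ⟨τ, t, h', hτg, hh', hrest', hd'⟩ := exists_layer_step hfib' hd
    -- Items of the first layer are home in `h`, whereas those of the second are not. Hence both are
    -- also layers from `f` to `h'`.
    have hst : ∀ v w, σ v ≠ v → τ w ≠ w → s v ≠ t w := fun v w hv hw he => by
      have h1 : h (s v) = g (s v) := by rw [hh.target v hv, hσg.target v hv]
      rw [he, hh'.source w hw, hτg.target w hw] at h1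
      exact hw h1.symm
    have hr : ReachIn 3 f h' := by
      refine reachIn_three_of_layers (σ := σ) (τ := τ) (s := s) (t := t)
        ⟨hh.source, fun v hv => ?_⟩ ⟨fun w hw => ?_, hh'.target⟩ hst fun j hj hj' => ?_
      · rw [hrest' _ fun w hw => hst v w hv hw, hh.target v hv]
      · rw [← hrest _ fun v hv => (hst v w hv hw).symm, hh'.source w hw]
      · rw [hrest' j hj', hrest j hj]
    have := hr.trans (ih (fun v => (hfib v).trans (hr.card_fiber v).symm) hd')
    convert this using 1
    omega

/-- While `v₀` is the unique cluster of maximum degree, a whole layer is not needed: its cycle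
through `v₀` is a single exchange that lowers the maximum. -/
theorem reachIn_of_moveDegree_le_of_ne [Fintype V] [Nonempty (V → J)] (k r : ℕ) (v₀ : V)
    {f g : J → V} (hfib : ∀ v, (Finset.univ.filter fun j => g j = v).card =
      (Finset.univ.filter fun j => f j = v).card) (h₀ : moveDegree f g v₀ ≤ k + r)
    (hdeg : ∀ v, v ≠ v₀ → moveDegree f g v ≤ k) :
    ReachIn (r + (k + (k + 1) / 2)) f g := by
  classical
  induction r generalizing f with
  | zero =>
    refine (reachIn_of_moveDegree_le k hfib fun v => ?_).mono (by simp)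
    by_cases hv : v = v₀
    · exact hv ▸ h₀
    · exact hdeg v hv
  | succ r ih =>
    by_cases hlt : moveDegree f g v₀ ≤ k + r
    · exact (ih hfib hlt hdeg).mono (by omega)
    have heq : moveDegree f g v₀ = k + r + 1 := by omega
    obtain ⟨σ, s, hl, hσ⟩ := exists_isLayer (k := k + r + 1) (by omega) hfib fun v => by
      by_cases hv : v = v₀
      · exact hv ▸ h₀
      · exact (hdeg v hv).trans (by omega)
    have hv₀ : σ v₀ ≠ v₀ := hσ v₀ heq
    have hY : ∀ v, σ.SameCycle v₀ v → σ v ≠ v := fun v hv h' =>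
      hv₀ (hv.apply_eq_self_iff.2 h')
    have hcyc : σ.IsCycleOn {v | σ.SameCycle v₀ v} := by
      refine ⟨(Set.toFinite _).injOn_iff_bijOn_of_mapsTo (fun v hv => ?_) |>.1
        σ.injective.injOn, fun v hv w hw => ?_⟩
      · exact Perm.sameCycle_apply_right.2 hv
      · exact Perm.SameCycle.trans (Perm.SameCycle.symm hv) hw
    obtain ⟨h, hh, hh₁, hh₂⟩ := exists_cyclicExchange (f := f) (t := s) hcyc
      fun v hv => hl.source v (hY v hv)
    have hle := moveDegree_add_le (f := f) (h := h) (g := g) (Y := {v | σ.SameCycle v₀ v})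
      (t := s) (fun v hv => ⟨hl.source v (hY v hv), by
        rw [hh₁ v hv, hl.target v (hY v hv)], by
        rw [hl.target v (hY v hv)]; exact hY v hv⟩) hh₂
    have h3 : ReachIn (r + (k + (k + 1) / 2)) h g := by
      refine ih (fun v => (hfib v).trans (hh.card_fiber v).symm) ?_ fun v hv =>
        (Nat.le_of_add_right_le (hle v)).trans (hdeg v hv)
      have := hle v₀
      rw [if_pos (show v₀ ∈ {v | σ.SameCycle v₀ v} from Perm.SameCycle.refl _ _)] at this
      omega
    convert hh.reachIn.trans h3 using 1
    omega

end

/-! ### Vertices and edges of the partition polytope -/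

section
variable {n m : ℕ}

/-- The 0/1-array of a clustering. -/
def clusterPoint (f : Fin m → Fin n) : Fin n → Fin m → ℝ := fun i j => if f j = i then 1 else 0

/-- `f` has clusters of sizes `κ`. -/
def HasClusterSizes (κ : Fin n → ℕ) (f : Fin m → Fin n) : Prop :=
  ∀ i, (Finset.univ.filter fun j => f j = i).card = κ i

theorem clusterPoint_injective : Function.Injective (clusterPoint (n := n) (m := m)) := by
  intro f g h
  funext j
  have := congrFun (congrFun h (g j)) j
  by_contra hne
  simp [clusterPoint, hne] at this

theorem HasClusterSizes.clusterPoint_mem {κ : Fin n → ℕ} {f : Fin m → Fin n}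
    (hf : HasClusterSizes κ f) : clusterPoint f ∈ partitionPolytope m κ := by
  refine ⟨fun i => ?_, fun j => ?_, fun i j => ?_⟩
  · simp [clusterPoint, ← hf i]
  · simp [clusterPoint]
  · simp only [clusterPoint]
    split_ifs <;> norm_num

theorem convex_partitionPolytope (κ : Fin n → ℕ) : Convex ℝ (partitionPolytope m κ) := by
  intro x hx y hy a b ha hb hab
  refine ⟨fun i => ?_, fun j => ?_, fun i j => ?_⟩
  · simp [Finset.sum_add_distrib, ← Finset.mul_sum, hx.1, hy.1, ← add_mul, hab]
  · simp [Finset.sum_add_distrib, ← Finset.mul_sum, hx.2.1, hy.2.1, hab]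
  · have h1 := hx.2.2 i j
    have h2 := hy.2.2 i j
    simp only [Pi.add_apply, Pi.smul_apply, smul_eq_mul]
    positivity

theorem eq_clusterPoint_of_support {κ : Fin n → ℕ} {f : Fin m → Fin n}
    {y : Fin n → Fin m → ℝ} (hy : y ∈ partitionPolytope m κ)
    (h : ∀ i j, f j ≠ i → y i j = 0) : y = clusterPoint f := by
  funext i j
  by_cases hij : f j = i
  · subst hij
    have := hy.2.1 j
    rw [Finset.sum_eq_single_of_mem (f j) (Finset.mem_univ _)
      fun i _ hi => h i j hi.symm] at this
    simp [clusterPoint, this]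
  · simp [clusterPoint, hij, h i j hij]

theorem HasClusterSizes.clusterPoint_mem_extremePoints {κ : Fin n → ℕ} {f : Fin m → Fin n}
    (hf : HasClusterSizes κ f) : clusterPoint f ∈ (partitionPolytope m κ).extremePoints ℝ := by
  rw [mem_extremePoints_iff_left]
  refine ⟨hf.clusterPoint_mem, fun x hx y hy ⟨a, b, ha, hb, hab, h⟩ => ?_⟩
  refine eq_clusterPoint_of_support hx fun i j hij => ?_
  have h1 := congrFun (congrFun h i) j
  simp only [Pi.add_apply, Pi.smul_apply, smul_eq_mul, clusterPoint, if_neg hij] at h1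
  have hx' := hx.2.2 i j
  have hy' := mul_nonneg hb.le (hy.2.2 i j)
  have : a * x i j = 0 := le_antisymm (by linarith) (by positivity)
  exact (mul_eq_zero.1 this).resolve_left ha.ne'

/-- Integrality of the partition polytope. -/
theorem partitionPolytope_subset_convexHull {κ : Fin n → ℕ} (hm : ∑ i, κ i = m) :
    partitionPolytope m κ ⊆ convexHull ℝ (clusterPoint '' {f | HasClusterSizes κ f}) := by
  classical
  intro y hy
  subst hm
  let e : (Σ i, Fin (κ i)) ≃ Fin (∑ i, κ i) := finSigmaFinEquiv
  -- Row `i` is split into `κ i` equal copies, giving a doubly stochastic matrix. In its Birkhoff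
  -- decomposition, merging the copies again turns permutations into clusterings.
  let M : Matrix (Fin (∑ i, κ i)) (Fin (∑ i, κ i)) ℝ :=
    fun a j => y (e.symm a).1 j / κ (e.symm a).1
  have hzero : ∀ i, κ i = 0 → ∀ j, y i j = 0 := fun i hi j => by
    have := hy.1 i
    rw [hi, Nat.cast_zero, Finset.sum_eq_zero_iff_of_nonneg fun j _ => hy.2.2 i j] at this
    exact this j (Finset.mem_univ j)
  have hsum : ∀ i j, ∑ s, M (e ⟨i, s⟩) j = y i j := fun i j => by
    simp only [M, Equiv.symm_apply_apply, Finset.sum_const, Finset.card_univ, Fintype.card_fin,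
      nsmul_eq_mul]
    by_cases hi : κ i = 0
    · simp [hi, hzero i hi j]
    · field_simp
  have hM : M ∈ doublyStochastic ℝ _ := by
    rw [mem_doublyStochastic_iff_sum]
    refine ⟨fun a j => div_nonneg (hy.2.2 _ _) (Nat.cast_nonneg _), fun a => ?_, fun j => ?_⟩
    · have : 0 < κ (e.symm a).1 := Fin.pos (e.symm a).2
      simp only [M]
      rw [← Finset.sum_div, hy.1, div_self (by positivity)]
    · rw [← e.sum_comp, Fintype.sum_sigma]
      simp only [hsum, hy.2.1]
  obtain ⟨w, hw, hw1, hwM⟩ := exists_eq_sum_perm_of_mem_doublyStochastic hM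
  let F : Equiv.Perm (Fin (∑ i, κ i)) → Fin (∑ i, κ i) → Fin n :=
    fun σ j => (e.symm (σ.symm j)).1
  have hF : ∀ σ, HasClusterSizes κ (F σ) := fun σ i => by
    rw [Finset.card_filter, ← (e.trans σ).sum_comp, Fintype.sum_sigma]
    simp [F]
  have hyF : y = ∑ σ, w σ • clusterPoint (F σ) := by
    funext i j
    rw [← hsum, ← hwM]
    simp only [Matrix.sum_apply, Finset.sum_apply, Pi.smul_apply, Matrix.smul_apply]
    rw [Finset.sum_comm]
    refine Finset.sum_congr rfl fun σ _ => ?_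
    rw [← Finset.smul_sum]
    congr 1
    simp only [Equiv.Perm.permMatrix, PEquiv.toMatrix_apply, Equiv.toPEquiv_apply,
      Option.mem_some_iff, clusterPoint, F]
    by_cases hij : (e.symm (σ.symm j)).1 = i
    · subst hij
      rw [if_pos rfl, Finset.sum_eq_single_of_mem (e.symm (σ.symm j)).2 (Finset.mem_univ _)]
      · simp
      · intro s _ hs
        rw [if_neg]
        rintro h
        have h' : (⟨(e.symm (σ.symm j)).1, s⟩ : Σ i, Fin (κ i)) = e.symm (σ.symm j) := by
          rw [Equiv.eq_symm_apply, Equiv.eq_symm_apply, h]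
        exact hs (eq_of_heq (Sigma.ext_iff.1 h').2)
    · rw [if_neg hij]
      refine Finset.sum_eq_zero fun s _ => if_neg ?_
      rintro rfl
      exact hij (by simp)
  rw [hyF]
  exact (convex_convexHull ℝ _).sum_mem (fun σ _ => hw σ) hw1
    fun σ _ => subset_convexHull ℝ _ ⟨F σ, hF σ, rfl⟩

theorem exists_eq_clusterPoint {κ : Fin n → ℕ} (hm : ∑ i, κ i = m) {y : Fin n → Fin m → ℝ}
    (hy : y ∈ (partitionPolytope m κ).extremePoints ℝ) :
    ∃ f, HasClusterSizes κ f ∧ y = clusterPoint f := by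
  have hP : partitionPolytope m κ = convexHull ℝ (clusterPoint '' {f | HasClusterSizes κ f}) :=
    (partitionPolytope_subset_convexHull hm).antisymm
      (convexHull_min (by rintro _ ⟨f, hf, rfl⟩; exact HasClusterSizes.clusterPoint_mem hf)
        (convex_partitionPolytope κ))
  rw [hP] at hy
  obtain ⟨f, hf, rfl⟩ := extremePoints_convexHull_subset hy
  exact ⟨f, hf, rfl⟩

/-- The face of the points supported on two clusterings is exposed. -/
theorem isExposed_of_support {κ : Fin n → ℕ} {f g : Fin m → Fin n} (hf : HasClusterSizes κ f)
    (hg : HasClusterSizes κ g)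
    (h : ∀ y ∈ partitionPolytope m κ, (∀ i j, f j ≠ i → g j ≠ i → y i j = 0) →
      y ∈ segment ℝ (clusterPoint f) (clusterPoint g)) :
    IsExposed ℝ (partitionPolytope m κ) (segment ℝ (clusterPoint f) (clusterPoint g)) := by
  intro _
  -- Minus the total mass outside the supports of `f` and `g`: it is at most `0` on the polytope,
  -- with equality exactly when `y` is supported there.
  let L : (Fin n → Fin m → ℝ) →ₗ[ℝ] ℝ :=
    { toFun := fun y => ∑ j, ∑ i, (if f j = i ∨ g j = i then (0 : ℝ) else -1) * y i j
      map_add' := fun x y => by simp [mul_add, Finset.sum_add_distrib]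
      map_smul' := fun a x => by
        simp only [Pi.smul_apply, smul_eq_mul, RingHom.id_apply, Finset.mul_sum]
        refine Finset.sum_congr rfl fun j _ => Finset.sum_congr rfl fun i _ => ?_
        ring }
  have hL : ∀ y, L y = ∑ j, ∑ i, (if f j = i ∨ g j = i then (0 : ℝ) else -1) * y i j :=
    fun _ => rfl
  have hterm : ∀ y ∈ partitionPolytope m κ, ∀ i j,
      (if f j = i ∨ g j = i then (0 : ℝ) else -1) * y i j ≤ 0 := fun y hy i j => by
    have := hy.2.2 i j
    split_ifs
    · simp
    · linarith
  have hle : ∀ y ∈ partitionPolytope m κ, L y ≤ 0 := fun y hy => (hL y).trans_le <|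
    Finset.sum_nonpos fun j _ => Finset.sum_nonpos fun i _ => hterm y hy i j
  have hLf : L (clusterPoint f) = 0 :=
    (hL _).trans <| Finset.sum_eq_zero fun j _ => Finset.sum_eq_zero fun i _ => by
      by_cases hi : f j = i <;> simp [clusterPoint, hi]
  have hLg : L (clusterPoint g) = 0 :=
    (hL _).trans <| Finset.sum_eq_zero fun j _ => Finset.sum_eq_zero fun i _ => by
      by_cases hi : g j = i <;> simp [clusterPoint, hi]
  refine ⟨L.toContinuousLinearMap, Set.ext fun y => ⟨fun hy => ?_, fun hy => ?_⟩⟩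
  · refine ⟨(convex_partitionPolytope κ).segment_subset hf.clusterPoint_mem hg.clusterPoint_mem hy,
      fun z hz => ?_⟩
    obtain ⟨a, b, -, -, -, rfl⟩ := hy
    simpa [hLf, hLg] using hle z hz
  · refine h y hy.1 fun i j hi hj => ?_
    have h0 : L y = 0 := le_antisymm (hle y hy.1) (by simpa [hLf] using hy.2 _ hf.clusterPoint_mem)
    have h1 := (Finset.sum_eq_zero_iff_of_nonpos fun j _ =>
      Finset.sum_nonpos fun i _ => hterm y hy.1 i j).1 h0 j (Finset.mem_univ j)
    have h2 := (Finset.sum_eq_zero_iff_of_nonpos fun i _ => hterm y hy.1 i j).1 h1 i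
      (Finset.mem_univ i)
    simpa [hi, hj] using h2

/-- A supported point splits each moved item between its old and its new cluster. Row sums force the
same split all along the cycle, leaving one free parameter; two separate cycles would leave two. -/
theorem CyclicExchange.mem_segment {κ : Fin n → ℕ} {f g : Fin m → Fin n}
    (h : CyclicExchange f g) (hne : f ≠ g) (hf : HasClusterSizes κ f)
    {y : Fin n → Fin m → ℝ} (hy : y ∈ partitionPolytope m κ)
    (hsupp : ∀ i j, f j ≠ i → g j ≠ i → y i j = 0) :
    y ∈ segment ℝ (clusterPoint f) (clusterPoint g) := by
  obtain ⟨c, Y, t, hc, ht, hrest⟩ := h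
  obtain ⟨v₀, hv₀, hcv₀⟩ : ∃ v ∈ Y, c v ≠ v := by
    by_contra! hall
    refine hne (funext fun j => ?_)
    by_cases hj : ∃ v ∈ Y, j = t v
    · obtain ⟨v, hv, rfl⟩ := hj
      rw [(ht v hv).1, (ht v hv).2, hall v hv]
    · push Not at hj
      exact (hrest j hj).symm
  have hcne : ∀ v ∈ Y, c v ≠ v := fun v hv =>
    hc.apply_ne ⟨v₀, hv₀, c v₀, hc.1.1 hv₀, hcv₀.symm⟩ hv
  have hpair : ∀ v ∈ Y, y v (t v) + y (c v) (t v) = 1 := fun v hv => by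
    rw [← hy.2.1 (t v), ← Finset.sum_subset (Finset.subset_univ {v, c v}),
      Finset.sum_pair (hcne v hv).symm]
    intro i _ hi
    simp only [Finset.mem_insert, Finset.mem_singleton, not_or] at hi
    refine hsupp i _ ?_ ?_
    · rw [(ht v hv).1]; exact Ne.symm hi.1
    · rw [(ht v hv).2]; exact Ne.symm hi.2
  have hone : ∀ j, (∀ v ∈ Y, j ≠ t v) → ∀ i, y i j = clusterPoint f i j := fun j hj => by
    have h0 : ∀ i, f j ≠ i → y i j = 0 := fun i hi => hsupp i j hi (by rwa [hrest j hj])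
    intro i
    by_cases hi : f j = i
    · subst hi
      have := hy.2.1 j
      rw [Finset.sum_eq_single_of_mem (f j) (Finset.mem_univ _)
        fun i _ hi => h0 i hi.symm] at this
      simp [clusterPoint, this]
    · simp [clusterPoint, hi, h0 i hi]
  -- In row `c v` only the entries at `t v` and `t (c v)` can differ from those of `clusterPoint f`,
  -- so the share gained equals the share lost.
  have hstep : ∀ v ∈ Y, y (c v) (t (c v)) = y v (t v) := fun v hv => by
    have hcv := hc.1.1 hv
    have hrow : ∑ j, (y (c v) j - clusterPoint f (c v) j) = 0 := by
      rw [Finset.sum_sub_distrib, hy.1, hf.clusterPoint_mem.1, sub_self]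
    have htne : t v ≠ t (c v) := fun h' => hcne v hv (by
      rw [← (ht _ hcv).1, ← h', (ht v hv).1])
    rw [← Finset.sum_subset (Finset.subset_univ {t v, t (c v)}), Finset.sum_pair htne] at hrow
    · simp only [clusterPoint, (ht v hv).1, (ht _ hcv).1, if_neg (hcne v hv).symm, if_true] at hrow
      linarith [hpair v hv]
    · intro j _ hj
      simp only [Finset.mem_insert, Finset.mem_singleton, not_or] at hj
      rw [sub_eq_zero]
      by_cases hjt : ∃ w ∈ Y, j = t w
      · obtain ⟨w, hw, rfl⟩ := hjt
        have h1 : w ≠ c v := fun h' => hj.2 (by rw [h'])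
        have h2 : c w ≠ c v := fun h' => hj.1 (by rw [c.injective h'])
        rw [hsupp _ _ (by rwa [(ht w hw).1]) (by rwa [(ht w hw).2])]
        simp [clusterPoint, (ht w hw).1, h1]
      · push Not at hjt
        exact hone j hjt _
  have hconst : ∀ v ∈ Y, y v (t v) = y v₀ (t v₀) := fun v hv => by
    obtain ⟨i, -, rfl⟩ := (hc.2 hv₀ hv).exists_pow_eq'
    have key : ∀ i : ℕ, (c ^ i) v₀ ∈ Y ∧ y ((c ^ i) v₀) (t ((c ^ i) v₀)) = y v₀ (t v₀) := by
      intro i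
      induction i with
      | zero => exact ⟨hv₀, rfl⟩
      | succ i ih =>
        rw [pow_succ', Equiv.Perm.mul_apply]
        exact ⟨hc.1.1 ih.1, (hstep _ ih.1).trans ih.2⟩
    exact (key i).2
  refine ⟨y v₀ (t v₀), y (c v₀) (t v₀), hy.2.2 _ _, hy.2.2 _ _, hpair v₀ hv₀, ?_⟩
  funext i j
  simp only [Pi.add_apply, Pi.smul_apply, smul_eq_mul]
  by_cases hjt : ∃ w ∈ Y, j = t w
  · obtain ⟨w, hw, rfl⟩ := hjt
    have h1 := hconst w hw
    have h2 := hpair w hw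
    have h3 := hpair v₀ hv₀
    by_cases hi : i = w
    · subst hi
      simp [clusterPoint, ht i hw, hcne i hw, h1]
    by_cases hi' : i = c w
    · subst hi'
      simp only [clusterPoint, (ht w hw).1, (ht w hw).2, if_neg (Ne.symm hi), if_true]
      linarith
    · rw [hsupp i _ (by rw [(ht w hw).1]; exact Ne.symm hi) (by rw [(ht w hw).2]; exact Ne.symm hi')]
      simp [clusterPoint, ht w hw, Ne.symm hi, Ne.symm hi']
  · push Not at hjt
    have hg : clusterPoint g i j = clusterPoint f i j := by simp [clusterPoint, hrest j hjt]
    rw [hone j hjt, hg, ← add_mul, hpair v₀ hv₀, one_mul]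

theorem ReachIn.edist_le {κ : Fin n → ℕ} {k : ℕ} {f g : Fin m → Fin n} (h : ReachIn k f g)
    (hf : HasClusterSizes κ f) (hg : HasClusterSizes κ g) :
    (polytopeGraph (partitionPolytope m κ)).edist
      ⟨clusterPoint f, hf.clusterPoint_mem_extremePoints⟩
      ⟨clusterPoint g, hg.clusterPoint_mem_extremePoints⟩ ≤ k := by
  induction k generalizing f with
  | zero =>
    obtain rfl : f = g := h
    simp
  | succ k ih =>
    obtain ⟨f', hff', hf'g⟩ := h
    have hf' : HasClusterSizes κ f' := fun i => (hff'.card_fiber i).trans (hf i)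
    have h1 : (polytopeGraph (partitionPolytope m κ)).edist
        ⟨clusterPoint f, hf.clusterPoint_mem_extremePoints⟩
        ⟨clusterPoint f', hf'.clusterPoint_mem_extremePoints⟩ ≤ 1 := by
      rw [SimpleGraph.edist_le_one_iff_adj_or_eq]
      by_cases hne : f = f'
      · subst hne
        exact .inr rfl
      · exact .inl ⟨fun h' => hne (clusterPoint_injective (congrArg Subtype.val h')),
          isExposed_of_support hf hf' fun y hy hs => hff'.mem_segment hne hf hy hs⟩
    refine SimpleGraph.edist_triangle.trans ((add_le_add h1 (ih hf'g hf')).trans ?_)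
    rw [Nat.cast_succ, add_comm]

end

/-! ### The diameter bound -/

theorem combinatorialDiameter_partitionPolytope_le (m n : ℕ) (κ : Fin n → ℕ)
    (hm : ∑ i, κ i = m) (hκ : Antitone κ) :
    combinatorialDiameter (partitionPolytope m κ) ≤
      ((clusterSize κ 1 + (clusterSize κ 2 + 1) / 2 : ℕ) : ℕ∞) := by
  by_cases hn : n = 0
  · subst hn
    have : (polytopeGraph (partitionPolytope m κ)).ediam = 0 :=
      SimpleGraph.ediam_eq_zero_of_subsingleton
    exact this.le.trans zero_le
  -- Without items there is no map `Fin n → Fin m` to serve as a default choice of items, so this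
  -- case is separate.
  by_cases hm0 : m = 0
  · subst hm0
    have : (polytopeGraph (partitionPolytope 0 κ)).ediam = 0 :=
      SimpleGraph.ediam_eq_zero_of_subsingleton
    exact this.le.trans zero_le
  have hJ : Nonempty (Fin n → Fin m) := ⟨fun _ => ⟨0, by omega⟩⟩
  refine SimpleGraph.ediam_le_of_edist_le fun ⟨x, hx⟩ ⟨y, hy⟩ => ?_
  obtain ⟨f, hf, rfl⟩ := exists_eq_clusterPoint hm hx
  obtain ⟨g, hg, rfl⟩ := exists_eq_clusterPoint hm hy
  refine ReachIn.edist_le ?_ hf hg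
  let v₀ : Fin n := ⟨0, by omega⟩
  have h1 : clusterSize κ 1 = κ v₀ := by simp [clusterSize, v₀, Nat.one_le_iff_ne_zero, hn]
  have hdeg : ∀ v, moveDegree f g v ≤ κ v := fun v => by
    rw [← hf v]
    exact Finset.card_le_card fun j hj => by
      simp only [Finset.mem_filter, Finset.mem_univ, true_and] at hj ⊢
      exact hj.1
  have h2 : ∀ v, v ≠ v₀ → κ v ≤ clusterSize κ 2 := fun v hv => by
    have hv0 : (v : ℕ) ≠ 0 := fun h => hv (Fin.ext h)
    have hv' := v.2
    rw [clusterSize, dif_pos ⟨by omega, by omega⟩]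
    exact hκ (Fin.le_def.2 (by simp only; omega))
  have h21 : clusterSize κ 2 ≤ κ v₀ := by
    rw [clusterSize]
    split_ifs
    · exact hκ (Fin.le_def.2 (by simp [v₀]))
    · exact Nat.zero_le _
  -- Degrees are bounded by cluster sizes, so only `v₀`, a largest cluster, can exceed `κ₂`, and by
  -- at most `κ₁ - κ₂`.
  have := reachIn_of_moveDegree_le_of_ne (clusterSize κ 2) (κ v₀ - clusterSize κ 2) v₀
    (fun v => (hg v).trans (hf v).symm) ((hdeg v₀).trans (by omega))
    fun v hv => (hdeg v).trans (h2 v hv)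
  convert this using 1
  omega

theorem natCeil_half (a : ℕ) : ⌈(a : ℝ) / 2⌉₊ = (a + 1) / 2 := by
  refine le_antisymm (Nat.ceil_le.2 ?_) ?_
  · have : (a : ℝ) ≤ 2 * ((a + 1) / 2 : ℕ) := by exact_mod_cast (by omega)
    linarith
  · have h := Nat.le_ceil ((a : ℝ) / 2)
    have : (a : ℝ) ≤ 2 * (⌈(a : ℝ) / 2⌉₊ : ℕ) := by linarith
    have : a ≤ 2 * ⌈(a : ℝ) / 2⌉₊ := by exact_mod_cast this
    omega

theorem clusterSize_two_le {n : ℕ} {κ : Fin n → ℕ} (hκ : Antitone κ) :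
    clusterSize κ 2 ≤ clusterSize κ 1 := by
  rw [clusterSize]
  split_ifs with h
  · rw [clusterSize, dif_pos ⟨le_rfl, by omega⟩]
    exact hκ (Fin.le_def.2 (by simp))
  · exact Nat.zero_le _

theorem theorem1p1 (m n : ℕ) (κ : Fin n → ℕ) (hm : ∑ i, κ i = m) (hκ : Antitone κ) :
    combinatorialDiameter (partitionPolytope m κ) ≤
        ((clusterSize κ 1 + ⌈(clusterSize κ 2 : ℝ) / 2⌉₊ : ℕ) : ℕ∞) ∧
      combinatorialDiameter (partitionPolytope m κ) ≤
        ((⌈3 * (clusterSize κ 1 : ℝ) / 2⌉₊ : ℕ) : ℕ∞) := by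
  have h := combinatorialDiameter_partitionPolytope_le m n κ hm hκ
  have h3 := natCeil_half (3 * clusterSize κ 1)
  push_cast at h3
  rw [natCeil_half, h3]
  refine ⟨h, h.trans (Nat.cast_le.2 ?_)⟩
  have := clusterSize_two_le hκ
  omega
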